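/- Let $K$ be an algebraically closed field, let $H\subseteq K[X]=K[x_1,\dots,x_n]$ be an ideal, let $T=(t_1,\dots,t_r)\subseteq K[X]$ be an ideal given by generators, and let $U\subseteq\{x_1,\dots,x_n\}$ be a set of variables which is independent for $H$, i.e. $H\cap K[U]=0$, and such that $|U|=\dim H$ (the Krull dimension of $K[X]/H$). A component of $H$ is the variety $\mathbb V(P)\subseteq K^n$ of a minimal prime $P$ over $H$; $U$ remains independent on it if $P\cap K[U]=0$. For an ideal $I\subseteq K[U][y]$ in finitely many variables $y$, with parameters $U$, and a monomial order on the $y$, write $\sigma_{u_0}:K[U][y]\to K[y]$ for the specialization of the parameters at $u_0\in K^U$. A minimal canonical comprehensive Gröbner system (MCCGS) of $I$ with respect to $U$ is a finite family of pairs $(S_i,B_i)$ such that: (1) the $S_i$ (the segments) are nonempty constructible sets forming a partition of $K^U$; (2) each $B_i\subset K[U][y]$ is a finite set of polynomials of content $1$ with respect to $y$, whose leading coefficients vanish nowhere on $S_i$, and for every $u_0\in S_i$ the polynomials $\sigma_{u_0}(b)$, $b\in B_i$, divided by their leading coefficients, are pairwise distinct and form the reduced Gröbner basis of $\sigma_{u_0}(I)$;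 (3) no family with (1) and (2) has fewer segments. The generic segment is the unique segment containing a nonempty Zariski-open subset of $K^U$; its basis is called $1$ if it consists of a single nonzero constant of $K$. Take any MCCGS with respect to $U$, for any monomial orders, of the ideal $\{H,Tz-1\}$, that is, the ideal generated by $H$ and $t_1z_1+\dots+t_rz_r-1$ in $K[U][X\setminus U,z_1,\dots,z_r]$ (for a single polynomial $T$: by $H$ and $Tz-1$), and of the ideal $\{H,T\}=H+T$ in $K[U][X\setminus U]$. Then $T$ vanishes identically on some component of $H$ where $U$ remains independent, and also $T$ does not vanish identically on some other component of $H$ where $U$ remains independent, if and only if - the basis of the generic segment of the MCCGS of $\{H,Tz-1\}$ is different from $1$, and - the basis of the generic segment of the MCCGS of $\{H,T\}$ is different from $1$. -/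

import Mathlib

open MvPolynomial

noncomputable section

namespace ParamGB

/-! ### Reduced Gröbner bases over a field -/

/-- `G` is a Gröbner basis of the ideal `J`: it is a subset of `J` and its leading terms generate
the ideal of leading terms of `J`. -/
def IsGroebnerBasis {ν K : Type*} [Field K] (m : MonomialOrder ν)
    (G : Set (MvPolynomial ν K)) (J : Ideal (MvPolynomial ν K)) : Prop :=
  G ⊆ J ∧ Ideal.span (m.leadingTerm '' G) = Ideal.span (m.leadingTerm '' (J : Set _))

/-- The reduced Gröbner basis: a finite Gröbner basis of monic polynomials in which no power
product of an element is divisible by the leading power product of another element. -/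
def IsReducedGroebnerBasis {ν K : Type*} [Field K] (m : MonomialOrder ν)
    (G : Set (MvPolynomial ν K)) (J : Ideal (MvPolynomial ν K)) : Prop :=
  G.Finite ∧ IsGroebnerBasis m G J ∧ (∀ g ∈ G, m.Monic g) ∧
    ∀ g ∈ G, ∀ g' ∈ G, g' ≠ g → ∀ d ∈ g.support, ¬ m.degree g' ≤ d

/-- Divide a polynomial over a field by its leading coefficient. -/
def monicNormalization {ν K : Type*} [Field K] (m : MonomialOrder ν)
    (f : MvPolynomial ν K) : MvPolynomial ν K :=
  C (m.leadingCoeff f)⁻¹ * f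

/-! ### Parametric polynomials: coefficients in `A = K[u]`, parameters `u` indexed by `μ`,
variables `x` indexed by `ν` -/

/-- The specialization homomorphism `K[u][x] → K[x]`, substituting `u₀` for the parameters. -/
def specialize {ν μ K : Type*} [Field K] (u₀ : μ → K) :
    MvPolynomial ν (MvPolynomial μ K) →+* MvPolynomial ν K :=
  MvPolynomial.map (MvPolynomial.eval u₀)

/-- Content `1` with respect to the variables: the only common divisors in `K[u]` of the
coefficients are the nonzero constants. -/
def HasContentOne {ν μ K : Type*} [Field K] (b : MvPolynomial ν (MvPolynomial μ K)) : Prop :=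
  ∀ c : MvPolynomial μ K, (∀ d : ν →₀ ℕ, c ∣ b.coeff d) → IsUnit c

/-- Constructible subsets of the affine space `K^μ`: finite unions of differences of two Zariski
closed sets. -/
def IsConstructibleSet {μ K : Type*} [Field K] (S : Set (μ → K)) : Prop :=
  ∃ (k : ℕ) (F G : Fin k → Ideal (MvPolynomial μ K)),
    S = ⋃ j, zeroLocus K (F j) \ zeroLocus K (G j)

/-- A finite list of pairs (segment, finite set of parametric polynomials). -/
structure System (ν μ K : Type*) [Field K] where
  /-- the number of segments -/
  size : ℕ
  /-- the segments, subsets of the parameter space -/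
  segment : Fin size → Set (μ → K)
  /-- the set of polynomials attached to each segment -/
  basis : Fin size → Finset (MvPolynomial ν (MvPolynomial μ K))

/-- The segments are nonempty constructible sets which form a partition of the parameter space. -/
structure System.IsPartition {ν μ K : Type*} [Field K] (𝒢 : System ν μ K) : Prop where
  constructible : ∀ i, IsConstructibleSet (𝒢.segment i)
  nonempty : ∀ i, (𝒢.segment i).Nonempty
  disjoint : ∀ i j, i ≠ j → Disjoint (𝒢.segment i) (𝒢.segment j)
  cover : ⋃ i, 𝒢.segment i = Set.univ

/-- The polynomials of each basis have content `1`, their leading coefficients vanish nowhere on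
the segment (so the leading power products are kept), and, for each point `u₀` of the segment,
they specialize one-to-one (up to the nonzero leading coefficients) to the reduced Gröbner basis
of the specialized ideal. -/
structure System.SpecializesToReduced {ν μ K : Type*} [Field K] (𝒢 : System ν μ K)
    (m : MonomialOrder ν) (I : Ideal (MvPolynomial ν (MvPolynomial μ K))) : Prop where
  content : ∀ i, ∀ b ∈ 𝒢.basis i, HasContentOne b
  leadingCoeff_ne_zero : ∀ i, ∀ b ∈ 𝒢.basis i, ∀ u₀ ∈ 𝒢.segment i,
    MvPolynomial.eval u₀ (m.leadingCoeff b) ≠ 0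
  injOn : ∀ i, ∀ u₀ ∈ 𝒢.segment i,
    Set.InjOn (fun b => monicNormalization m (specialize u₀ b)) (𝒢.basis i : Set _)
  reduced : ∀ i, ∀ u₀ ∈ 𝒢.segment i,
    IsReducedGroebnerBasis m
      ((fun b => monicNormalization m (specialize u₀ b)) '' (𝒢.basis i : Set _))
      (I.map (specialize u₀))

/-- `𝒢` is a minimal comprehensive Gröbner system of the parametric ideal `I` with reduced
bases: among all partitions with bases specializing to the reduced Gröbner bases it has the
smallest number of segments. -/
structure System.IsMCCGS {ν μ K : Type*} [Field K] (𝒢 : System ν μ K)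
    (m : MonomialOrder ν) (I : Ideal (MvPolynomial ν (MvPolynomial μ K))) : Prop where
  partition : 𝒢.IsPartition
  specializes : 𝒢.SpecializesToReduced m I
  minimal : ∀ 𝒢' : System ν μ K, 𝒢'.IsPartition → 𝒢'.SpecializesToReduced m I →
    𝒢.size ≤ 𝒢'.size

/-- The generic segment: the one containing a nonempty Zariski open subset of the parameter space
(equivalently, the nonvanishing locus of a nonzero polynomial). -/
def System.IsGenericSegment {ν μ K : Type*} [Field K] (𝒢 : System ν μ K) (i : Fin 𝒢.size) :
    Prop :=
  ∃ g : MvPolynomial μ K, g ≠ 0 ∧ {u₀ : μ → K | MvPolynomial.eval u₀ g ≠ 0} ⊆ 𝒢.segment i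

/-- The basis is `1`. As content `1` fixes polynomials only up to nonzero scalars of `K`,
so does this. -/
def BasisIsOne {ν μ K : Type*} [Field K] (B : Finset (MvPolynomial ν (MvPolynomial μ K))) :
    Prop :=
  ∃ c : K, c ≠ 0 ∧ B = {C (C c)}

/-- There is a generic segment and its basis is different from `1`. -/
def System.GenericBasisNeOne {ν μ K : Type*} [Field K] (𝒢 : System ν μ K) : Prop :=
  ∃ i, 𝒢.IsGenericSegment i ∧ ¬ BasisIsOne (𝒢.basis i)

/-! ### Hypotheses, theses, independent components -/

/-- The variables in `U` are independent for the ideal `J`: `J ∩ K[U] = 0`. -/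
def IndependentFor {n : ℕ} {K : Type*} [Field K] (U : Finset (Fin n))
    (J : Ideal (MvPolynomial (Fin n) K)) : Prop :=
  ∀ g : MvPolynomial {i // i ∈ U} K, rename Subtype.val g ∈ J → g = 0

/-- The components of `H` (given by the minimal primes over `H`) on which `U` remains
independent. -/
def independentComponents {n : ℕ} {K : Type*} [Field K] (U : Finset (Fin n))
    (H : Ideal (MvPolynomial (Fin n) K)) : Set (Ideal (MvPolynomial (Fin n) K)) :=
  {P | P ∈ H.minimalPrimes ∧ IndependentFor U P}

/-- All polynomials of the family `t` vanish at all points of the variety of `P`. -/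
def VanishesOn {n r : ℕ} {K : Type*} [Field K] (t : Fin r → MvPolynomial (Fin n) K)
    (P : Ideal (MvPolynomial (Fin n) K)) : Prop :=
  ∀ a ∈ zeroLocus K P, ∀ j, MvPolynomial.eval a (t j) = 0

/-- View a polynomial of `K[X]` as an element of `K[U][X ∖ U]`: the variables in `U` become
parameters. -/
def toParametric {n : ℕ} {K : Type*} [Field K] (U : Finset (Fin n)) :
    MvPolynomial (Fin n) K →ₐ[K] MvPolynomial {i // i ∉ U} (MvPolynomial {i // i ∈ U} K) :=
  aeval fun i => if h : i ∈ U then C (X ⟨i, h⟩) else X ⟨i, h⟩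

/-- The parametric ideal generated by `H` and `T = (t₁, …, t_r)`. -/
def idealHT {n r : ℕ} {K : Type*} [Field K] (U : Finset (Fin n))
    (H : Ideal (MvPolynomial (Fin n) K)) (t : Fin r → MvPolynomial (Fin n) K) :
    Ideal (MvPolynomial {i // i ∉ U} (MvPolynomial {i // i ∈ U} K)) :=
  (H ⊔ Ideal.span (Set.range t)).map (toParametric U)

/-- The parametric ideal generated by `H` and `t₁ z₁ + ⋯ + t_r z_r - 1`, with new variables
`z₁, …, z_r`. For a single thesis polynomial `T` this is the ideal generated by `H` and
`T z - 1`. -/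
def idealHTz {n r : ℕ} {K : Type*} [Field K] (U : Finset (Fin n))
    (H : Ideal (MvPolynomial (Fin n) K)) (t : Fin r → MvPolynomial (Fin n) K) :
    Ideal (MvPolynomial ({i // i ∉ U} ⊕ Fin r) (MvPolynomial {i // i ∈ U} K)) :=
  Ideal.span
    ((fun h => rename Sum.inl (toParametric U h)) '' (H : Set _) ∪
      {∑ j, rename Sum.inl (toParametric U (t j)) * X (Sum.inr j) - 1})

end ParamGB

end

/-!
Over the algebraically closed field `K`, the generic basis of a comprehensive Gröbner system of a
parametric ideal `I` is `1` if and only if `I` contains a nonzero polynomial in the parameters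
alone: the reduced Gröbner basis at a point `u₀` is `{1}` exactly when the specialized ideal is the
unit ideal, and by the Nullstellensatz the specialized ideals are trivial wherever `g` does not
vanish exactly when a power of `g` lies in `I`.

It remains to eliminate the variables outside `U` from the two ideals. For `{H, T}` this gives
`(H + T) ∩ K[U]`, and for `{H, Tz - 1}` it gives, up to radicals, `(√H : T) ∩ K[U]`. An ideal for
which `U` is independent has a minimal prime for which `U` is independent. A minimal prime of
`√H : T` contains a minimal prime of `H` not containing `T`, and a prime over `H + T` for which `U`
is independent is minimal over `H` because `dim H = |U|`.
-/

section KrullDimension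

lemma ringKrullDim_le_of_isIntegral {R S : Type*} [CommRing R] [CommRing S] [Algebra R S]
    [Algebra.IsIntegral R S] [FaithfulSMul R S] : ringKrullDim R ≤ ringKrullDim S := by
  refine iSup_le fun l => ?_
  obtain ⟨Q, hQ⟩ := Algebra.IsIntegral.comap_surjective R S l.head
  have : Q.asIdeal.LiesOver l.head.asIdeal := ⟨congrArg PrimeSpectrum.asIdeal hQ.symm⟩
  obtain ⟨L, hL, -⟩ := Ideal.exists_ltSeries_of_hasGoingUp l Q.asIdeal
  exact hL ▸ le_iSup (fun p : LTSeries (PrimeSpectrum S) => ((p.length : ℕ∞) : WithBot ℕ∞)) L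

lemma toNat_trdeg_le_ringKrullDim (K A : Type*) [Field K] [CommRing A] [IsDomain A] [Algebra K A]
    [Algebra.FiniteType K A] :
    (Cardinal.toNat (Algebra.trdeg K A) : WithBot ℕ∞) ≤ ringKrullDim A := by
  obtain ⟨s, g, hg, hint⟩ := exists_integral_inj_algHom_of_fg K A
  let _ := g.toRingHom.toAlgebra
  have : IsScalarTower K (MvPolynomial (Fin s) K) A :=
    IsScalarTower.of_algebraMap_eq fun x => (g.commutes x).symm
  have : Algebra.IsIntegral (MvPolynomial (Fin s) K) A := ⟨hint⟩
  have : FaithfulSMul (MvPolynomial (Fin s) K) A :=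
    (faithfulSMul_iff_algebraMap_injective _ _).mpr hg
  have htrdeg : Cardinal.toNat (Algebra.trdeg K A) = s := by
    have h := lift_trdeg_add_eq K (MvPolynomial (Fin s) K) A
    rw [trdeg_eq_zero (R := MvPolynomial (Fin s) K)] at h
    simpa using (congrArg Cardinal.toNat h).symm
  calc (Cardinal.toNat (Algebra.trdeg K A) : WithBot ℕ∞)
      = ringKrullDim (MvPolynomial (Fin s) K) := by
        rw [htrdeg, ringKrullDim_of_isNoetherianRing, ringKrullDim_eq_zero_of_field]
        simp
    _ ≤ ringKrullDim A := ringKrullDim_le_of_isIntegral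

lemma natCard_le_ringKrullDim_of_algebraicIndependent {K A ι : Type*} [Field K] [CommRing A]
    [IsDomain A] [Algebra K A] [Algebra.FiniteType K A] {x : ι → A}
    (hx : AlgebraicIndependent K x) : (Nat.card ι : WithBot ℕ∞) ≤ ringKrullDim A := by
  refine le_trans ?_ (toNat_trdeg_le_ringKrullDim K A)
  have h := Cardinal.toNat_le_toNat hx.lift_cardinalMk_le_trdeg
    (Cardinal.lift_lt_aleph0.mpr trdeg_lt_aleph0_of_finiteType)
  rw [Cardinal.toNat_lift, Cardinal.toNat_lift] at h
  exact_mod_cast h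

lemma ringKrullDim_quotient_add_one_le_of_lt {R : Type*} [CommRing R] {P Q : Ideal R} [P.IsPrime]
    (hlt : P < Q) : ringKrullDim (R ⧸ Q) + 1 ≤ ringKrullDim (R ⧸ P) := by
  obtain ⟨x, hxQ, hxP⟩ := SetLike.exists_of_lt hlt
  refine ringKrullDim_succ_le_of_surjective (Ideal.Quotient.factor hlt.le)
    (Ideal.Quotient.factor_surjective hlt.le) (r := Ideal.Quotient.mk P x)
    (mem_nonZeroDivisors_of_ne_zero ?_) ?_
  · rwa [Ne, Ideal.Quotient.eq_zero_iff_mem]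
  · simpa [Ideal.Quotient.eq_zero_iff_mem] using hxQ

end KrullDimension

section Colon

variable {R : Type*} [CommRing R] {I P : Ideal R} {T : Set R}

lemma radical_colon_le_of_isPrime [hP : P.IsPrime] (hIP : I ≤ P) (hT : ¬ T ⊆ P) :
    I.radical.colon T ≤ P := by
  obtain ⟨t, htT, htP⟩ := Set.not_subset.mp hT
  intro a ha
  exact (hP.mem_or_mem (hP.radical_le_iff.mpr hIP (Submodule.mem_colon.mp ha t htT))).resolve_right
    htP

lemma exists_minimalPrimes_le_of_radical_colon_le [IsNoetherianRing R] [hP : P.IsPrime]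
    (h : I.radical.colon T ≤ P) : ∃ Q ∈ I.minimalPrimes, Q ≤ P ∧ ¬ T ⊆ Q := by
  have hfin := I.finite_minimalPrimes_of_isNoetherianRing
  have hrad : I.radical = hfin.toFinset.inf id := by
    rw [← Ideal.sInf_minimalPrimes, Finset.inf_id_eq_sInf, hfin.coe_toFinset]
  rw [hrad, Submodule.colon_finsetInf, hP.inf_le'] at h
  obtain ⟨Q, hQ, hQP⟩ := h
  refine ⟨Q, hfin.mem_toFinset.mp hQ, Ideal.le_colon.trans hQP, fun hTQ => hP.ne_top ?_⟩
  rwa [id, (Submodule.colon_eq_top_iff_subset T).mpr hTQ, top_le_iff] at hQP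

lemma comap_colon_image {S : Type*} [CommRing S] (f : R →+* S) (J : Ideal S) (T : Set R) :
    (J.colon (f '' T)).comap f = (J.comap f).colon T := by
  ext a
  simp [Submodule.mem_colon]

end Colon

lemma comap_radical_eq_bot_iff {R S : Type*} [CommRing R] [IsReduced R] [CommRing S]
    {f : R →+* S} {J : Ideal S} : J.radical.comap f = ⊥ ↔ J.comap f = ⊥ := by
  rw [Ideal.comap_radical]
  refine ⟨fun h => le_bot_iff.mp (Ideal.le_radical.trans h.le), fun h => ?_⟩
  rw [h, Ideal.radical_bot_of_isReduced]

section Rabinowitsch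

variable {R ν σ : Type*} [CommRing R] [Fintype σ]

/-- The ideal generated by `J` and `∑ j, t j * z j - 1`, with new variables `z j`, which appears in
Rabinowitsch's trick for the family `t`. -/
noncomputable def rabinowitschIdeal (J : Ideal (MvPolynomial ν R)) (t : σ → MvPolynomial ν R) :
    Ideal (MvPolynomial (ν ⊕ σ) R) :=
  J.map (rename Sum.inl) ⊔ Ideal.span {∑ j, rename Sum.inl (t j) * X (Sum.inr j) - 1}

variable {J Q : Ideal (MvPolynomial ν R)} {t : σ → MvPolynomial ν R}

lemma comap_radical_rabinowitschIdeal_le_of_isPrime [Q.IsPrime] (hJQ : J ≤ Q) {j : σ}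
    (hj : t j ∉ Q) :
    (rabinowitschIdeal J t).radical.comap (rename (Sum.inl : ν → ν ⊕ σ)) ≤ Q := by
  classical
  let π := IsScalarTower.toAlgHom R (MvPolynomial ν R) Q.ResidueField
  have hπ (p) : π p = 0 ↔ p ∈ Q := Ideal.algebraMap_residueField_eq_zero
  -- `z` extends the generic point of the variety of `Q` to a zero of `∑ j, t j * z j - 1`.
  let z : σ → Q.ResidueField := fun i => if i = j then (π (t j))⁻¹ else 0
  let ψ : MvPolynomial (ν ⊕ σ) R →ₐ[R] Q.ResidueField := aeval (Sum.elim (fun i => π (X i)) z)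
  have hψ (p) : ψ (rename Sum.inl p) = π p := by
    have : ψ.comp (rename Sum.inl) = π := by
      ext i
      simp [ψ]
    exact DFunLike.congr_fun this p
  have hker : rabinowitschIdeal J t ≤ RingHom.ker ψ := by
    refine sup_le (Ideal.map_le_iff_le_comap.mpr fun p hp => ?_) ?_
    · simpa [RingHom.mem_ker, hψ, hπ] using hJQ hp
    · rw [Ideal.span_singleton_le_iff_mem, RingHom.mem_ker]
      simp [hψ, ψ, z, mul_inv_cancel₀ (mt (hπ _).mp hj)]
  intro a ha
  have hψa : ψ (rename Sum.inl a) = 0 :=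
    (Ideal.IsPrime.radical_le_iff (RingHom.ker_isPrime ψ)).mpr hker ha
  rwa [hψ, hπ] at hψa

lemma comap_radical_rabinowitschIdeal :
    (rabinowitschIdeal J t).radical.comap (rename (Sum.inl : ν → ν ⊕ σ)) =
      J.radical.colon (Set.range t) := by
  refine le_antisymm (fun a ha => ?_) fun a ha => ?_
  · rw [J.radical_eq_sInf, Submodule.mem_colon]
    rintro _ ⟨j, rfl⟩
    refine Ideal.mem_sInf.mpr fun {Q} ⟨hJQ, hQ⟩ => ?_
    by_cases hj : t j ∈ Q
    · exact Q.mul_mem_left a hj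
    · exact Q.mul_mem_right _ (comap_radical_rabinowitschIdeal_le_of_isPrime hJQ hj ha)
  · set ι := rename (R := R) (Sum.inl : ν → ν ⊕ σ)
    set s := ∑ j, ι (t j) * X (Sum.inr j)
    have hs : s - 1 ∈ (rabinowitschIdeal J t).radical :=
      Ideal.le_radical (Ideal.mem_sup_right (Ideal.mem_span_singleton_self _))
    have has : ι a * s ∈ (rabinowitschIdeal J t).radical := by
      rw [Finset.mul_sum]
      refine Ideal.sum_mem _ fun j _ => ?_
      rw [← mul_assoc, ← map_mul]
      refine Ideal.mul_mem_right _ _ (Ideal.radical_mono le_sup_left (Ideal.map_radical_le ι ?_))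
      exact Ideal.mem_map_of_mem ι (Submodule.mem_colon.mp ha _ ⟨j, rfl⟩)
    simpa [mul_sub] using Ideal.sub_mem _ has (Ideal.mul_mem_left _ (ι a) hs)

end Rabinowitsch

section ZariskiDense

variable {μ K : Type*} [Field K]

lemma vanishingIdeal_univ [Infinite K] : vanishingIdeal K (Set.univ : Set (μ → K)) = ⊥ :=
  (Submodule.eq_bot_iff _).mpr fun f hf => MvPolynomial.funext fun u => by
    simpa [aeval_eq_eval] using hf u trivial

lemma exists_vanishingIdeal_eq_bot_of_iUnion {ι : Type*} [Finite ι] {S : ι → Set (μ → K)}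
    (h : vanishingIdeal K (⋃ i, S i) = ⊥) : ∃ i, vanishingIdeal K (S i) = ⊥ := by
  cases nonempty_fintype ι
  by_contra! hS
  choose f hfS hf using fun i => Submodule.exists_mem_ne_zero_of_ne_bot (hS i)
  have hprod : ∏ i, f i ≠ 0 := Finset.prod_ne_zero_iff.mpr fun i _ => hf i
  refine hprod ((Submodule.eq_bot_iff _).mp h _ fun u hu => ?_)
  obtain ⟨i, hi⟩ := Set.mem_iUnion.mp hu
  rw [map_prod]
  exact Finset.prod_eq_zero (Finset.mem_univ i) (hfS i u hi)

end ZariskiDense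

namespace ParamGB

section Systems

variable {ν μ K : Type*} [Field K]

lemma IsConstructibleSet.exists_ne_zero_subset {S : Set (μ → K)} (hS : IsConstructibleSet S)
    (hdense : vanishingIdeal K S = ⊥) :
    ∃ g : MvPolynomial μ K, g ≠ 0 ∧ {u₀ | eval u₀ g ≠ 0} ⊆ S := by
  obtain ⟨k, F, G, rfl⟩ := hS
  obtain ⟨j, hj⟩ := exists_vanishingIdeal_eq_bot_of_iUnion hdense
  have hF : F j = ⊥ := le_bot_iff.mp <|
    (le_vanishingIdeal_zeroLocus (F j)).trans
      ((vanishingIdeal_anti_mono Set.sdiff_subset).trans hj.le)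
  have hG : G j ≠ ⊥ := by
    rintro hG
    simp [hF, hG, vanishingIdeal_empty] at hj
  obtain ⟨g, hgG, hg⟩ := Submodule.exists_mem_ne_zero_of_ne_bot hG
  refine ⟨g, hg, fun u hu => Set.mem_iUnion.mpr ⟨j, by simp [hF], fun huG => hu ?_⟩⟩
  simpa [aeval_eq_eval] using huG g hgG

lemma System.IsPartition.exists_isGenericSegment [Infinite K] {𝒢 : System ν μ K}
    (h𝒢 : 𝒢.IsPartition) : ∃ i, 𝒢.IsGenericSegment i := by
  obtain ⟨i, hi⟩ := exists_vanishingIdeal_eq_bot_of_iUnion (h𝒢.cover ▸ vanishingIdeal_univ)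
  exact ⟨i, (h𝒢.constructible i).exists_ne_zero_subset hi⟩

lemma IsReducedGroebnerBasis.eq_singleton_one {m : MonomialOrder ν} {G : Set (MvPolynomial ν K)}
    (hG : IsReducedGroebnerBasis m G ⊤) : G = {1} := by
  obtain ⟨-, ⟨-, hspan⟩, hmonic, hred⟩ := hG
  have hone_mem_span : 1 ∈ Ideal.span (m.leadingTerm '' G) := by
    rw [hspan]
    exact Ideal.subset_span ⟨1, trivial, by simp [MonomialOrder.leadingTerm]⟩
  -- Otherwise all leading terms lie in the ideal of polynomials with zero constant term.
  have hone : 1 ∈ G := by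
    by_contra hone
    have hle : Ideal.span (m.leadingTerm '' G) ≤ RingHom.ker (constantCoeff (R := K) (σ := ν)) := by
      rw [Ideal.span_le]
      rintro _ ⟨g, hg, rfl⟩
      have hdeg : m.degree g ≠ 0 := fun hd => hone <| by
        have hgC := m.eq_C_of_degree_eq_zero hd
        rw [(hmonic g hg).leadingCoeff_eq_one, C_1] at hgC
        rwa [← hgC]
      classical
      simp [MonomialOrder.leadingTerm, RingHom.mem_ker, constantCoeff_eq, coeff_monomial, hdeg]
    simpa [RingHom.mem_ker] using hle hone_mem_span
  refine Set.eq_singleton_iff_unique_mem.mpr ⟨hone, fun g hg => ?_⟩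
  by_contra hne
  exact hred g hg 1 hone (Ne.symm hne) (m.degree g) (m.degree_mem_support (hmonic g hg).ne_zero)
    (by simp)

lemma eq_C_of_monicNormalization_eq_one {m : MonomialOrder ν} {f : MvPolynomial ν K}
    (hf : monicNormalization m f = 1) : f = C (m.leadingCoeff f) := by
  have hlc : m.leadingCoeff f ≠ 0 := by
    intro h
    simp [monicNormalization, h] at hf
  calc f = C (m.leadingCoeff f) * monicNormalization m f := by
        rw [monicNormalization, ← mul_assoc, ← C_mul, mul_inv_cancel₀ hlc, C_1, one_mul]
    _ = C (m.leadingCoeff f) := by rw [hf, mul_one]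

lemma degree_eq_zero_of_specialize_eq_C {m : MonomialOrder ν}
    {b : MvPolynomial ν (MvPolynomial μ K)} {u₀ : μ → K} (hb : eval u₀ (m.leadingCoeff b) ≠ 0)
    {c : K} (h : specialize u₀ b = C c) : m.degree b = 0 := by
  classical
  by_contra hdeg
  refine hb ?_
  have hcoeff := congrArg (coeff (m.degree b)) h
  rwa [specialize, coeff_map, coeff_C, if_neg (Ne.symm hdeg)] at hcoeff

lemma HasContentOne.isUnit_of_C {a : MvPolynomial μ K}
    (ha : HasContentOne (C a : MvPolynomial ν (MvPolynomial μ K))) : IsUnit a := by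
  classical
  refine ha a fun d => ?_
  rw [coeff_C]
  split_ifs
  exacts [dvd_rfl, dvd_zero a]

variable {𝒢 : System ν μ K} {m : MonomialOrder ν} {I : Ideal (MvPolynomial ν (MvPolynomial μ K))}

lemma System.SpecializesToReduced.basisIsOne_iff (h𝒢 : 𝒢.SpecializesToReduced m I)
    {i : Fin 𝒢.size} {u₀ : μ → K} (hu₀ : u₀ ∈ 𝒢.segment i) :
    BasisIsOne (𝒢.basis i) ↔ I.map (specialize u₀) = ⊤ := by
  have hred := h𝒢.reduced i u₀ hu₀
  constructor
  · rintro ⟨c, hc, hB⟩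
    refine (Ideal.eq_top_iff_one _).mpr (hred.2.1.1 ⟨C (C c), by simp [hB], ?_⟩)
    simp [monicNormalization, specialize, ← C_mul, hc]
  · intro htop
    rw [htop] at hred
    have himg := hred.eq_singleton_one
    have hnorm {b} (hb : b ∈ 𝒢.basis i) : monicNormalization m (specialize u₀ b) = 1 :=
      himg.subset ⟨b, hb, rfl⟩
    obtain ⟨b, hb, -⟩ := himg.superset rfl
    have hB : 𝒢.basis i = {b} := Finset.eq_singleton_iff_unique_mem.mpr
      ⟨hb, fun b' hb' => h𝒢.injOn i u₀ hu₀ hb' hb ((hnorm hb').trans (hnorm hb).symm)⟩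
    have hbC : b = C (m.leadingCoeff b) :=
      m.eq_C_of_degree_eq_zero <| degree_eq_zero_of_specialize_eq_C
        (h𝒢.leadingCoeff_ne_zero i b hb u₀ hu₀) (eq_C_of_monicNormalization_eq_one (hnorm hb))
    obtain ⟨c, hc, hbc⟩ := isUnit_iff_eq_C_of_isReduced.mp
      (hbC ▸ h𝒢.content i b hb : HasContentOne (C (m.leadingCoeff b))).isUnit_of_C
    exact ⟨c, hc.ne_zero, by rw [hB, hbC, hbc]⟩

lemma eval_specialize_sumAlgEquiv (a : ν ⊕ μ → K) (p : MvPolynomial (ν ⊕ μ) K) :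
    eval (a ∘ Sum.inl) (specialize (a ∘ Sum.inr) (sumAlgEquiv K ν μ p)) = eval a p := by
  have : (eval (a ∘ Sum.inl)).comp ((specialize (a ∘ Sum.inr)).comp
      (sumAlgEquiv K ν μ : MvPolynomial (ν ⊕ μ) K →+* _)) = eval a := by
    ext x
    · simp [specialize]
    · rcases x with x | x <;> simp [specialize]
  exact DFunLike.congr_fun this p

lemma C_mem_radical_iff_forall_map_specialize_eq_top [IsAlgClosed K] [Finite ν] [Finite μ]
    {g : MvPolynomial μ K} :
    C g ∈ I.radical ↔ ∀ u₀ : μ → K, eval u₀ g ≠ 0 → I.map (specialize u₀) = ⊤ := by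
  refine ⟨fun ⟨k, hk⟩ u₀ hu₀ => ?_, fun h => ?_⟩
  · refine Ideal.eq_top_of_isUnit_mem _ (Ideal.mem_map_of_mem (specialize u₀) hk) ?_
    simpa only [map_pow, specialize, map_C] using ((IsUnit.mk0 _ hu₀).map C).pow k
  · let e := sumAlgEquiv K ν μ
    suffices hmem : e.symm (C g) ∈ (I.comap e).radical by
      rwa [← Ideal.comap_radical, Ideal.mem_comap, AlgEquiv.apply_symm_apply] at hmem
    rw [← vanishingIdeal_zeroLocus_eq_radical (K := K), mem_vanishingIdeal_iff]
    intro a ha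
    rw [aeval_eq_eval]
    by_contra hne
    have hle : I.map (specialize (a ∘ Sum.inr)) ≤ RingHom.ker (eval (a ∘ Sum.inl)) := by
      refine Ideal.map_le_iff_le_comap.mpr fun p hp => ?_
      have hp0 := ha (e.symm p) (by simpa using hp)
      rw [aeval_eq_eval, ← eval_specialize_sumAlgEquiv] at hp0
      simpa [RingHom.mem_ker, e] using hp0
    rw [← eval_specialize_sumAlgEquiv] at hne
    rw [h (a ∘ Sum.inr) (by simpa [specialize, e] using hne), top_le_iff] at hle
    exact RingHom.ker_ne_top _ hle

lemma System.IsGenericSegment.basisIsOne_iff [IsAlgClosed K] [Finite ν] [Finite μ]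
    {i : Fin 𝒢.size} (hi : 𝒢.IsGenericSegment i) (h𝒢 : 𝒢.SpecializesToReduced m I) :
    BasisIsOne (𝒢.basis i) ↔ I.comap C ≠ ⊥ := by
  obtain ⟨f, hf, hfi⟩ := hi
  constructor
  · intro hone
    obtain ⟨k, hk⟩ := C_mem_radical_iff_forall_map_specialize_eq_top.mpr fun u₀ hu₀ =>
      (h𝒢.basisIsOne_iff (hfi hu₀)).mp hone
    rw [← map_pow] at hk
    exact Submodule.ne_bot_iff _ |>.mpr ⟨f ^ k, hk, pow_ne_zero k hf⟩
  · intro hI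
    have : Infinite K := IsAlgClosed.instInfinite
    obtain ⟨g, hgI, hg⟩ := Submodule.exists_mem_ne_zero_of_ne_bot hI
    obtain ⟨u₀, hu₀⟩ : ∃ u₀ : μ → K, eval u₀ (f * g) ≠ 0 := by
      by_contra! hzero
      exact mul_ne_zero hf hg (MvPolynomial.funext (by simpa using hzero))
    rw [map_mul] at hu₀
    exact (h𝒢.basisIsOne_iff (hfi (left_ne_zero_of_mul hu₀))).mpr
      (C_mem_radical_iff_forall_map_specialize_eq_top.mp (Ideal.le_radical hgI) u₀
        (right_ne_zero_of_mul hu₀))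

lemma System.genericBasisNeOne_iff [IsAlgClosed K] [Finite ν] [Finite μ] (hpart : 𝒢.IsPartition)
    (hspec : 𝒢.SpecializesToReduced m I) : 𝒢.GenericBasisNeOne ↔ I.comap C = ⊥ := by
  have : Infinite K := IsAlgClosed.instInfinite
  obtain ⟨i, hi⟩ := hpart.exists_isGenericSegment
  constructor
  · rintro ⟨j, hj, hne⟩
    rwa [hj.basisIsOne_iff hspec, not_not] at hne
  · exact fun hI => ⟨i, hi, fun hone => (hi.basisIsOne_iff hspec).mp hone hI⟩

end Systems

section Elimination

variable {n r : ℕ} {K : Type*} [Field K] {U : Finset (Fin n)}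
  {H J P : Ideal (MvPolynomial (Fin n) K)} {t : Fin r → MvPolynomial (Fin n) K}

lemma IndependentFor.mono (hJ : IndependentFor U J) (h : H ≤ J) : IndependentFor U H :=
  fun g hg => hJ g (h hg)

lemma IndependentFor.exists_minimalPrimes (hJ : IndependentFor U J) :
    ∃ P ∈ J.minimalPrimes, IndependentFor U P := by
  let ι : MvPolynomial {i // i ∈ U} K →+* MvPolynomial (Fin n) K := (rename Subtype.val).toRingHom
  have hbot : ⊥ ∈ (J.comap ι).minimalPrimes := by
    rw [(Submodule.eq_bot_iff (J.comap ι)).mpr hJ]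
    exact (IsDomain.minimalPrimes_eq_singleton_bot (MvPolynomial {i // i ∈ U} K)).superset rfl
  obtain ⟨P, hP, hPbot⟩ := Ideal.exists_minimalPrimes_comap_eq ι ⊥ hbot
  exact ⟨P, hP, (Submodule.eq_bot_iff _).mp hPbot⟩

lemma toParametric_bijective (U : Finset (Fin n)) :
    Function.Bijective (toParametric (K := K) U) := by
  let e : Fin n ≃ {i // i ∉ U} ⊕ {i // i ∈ U} :=
    (Equiv.sumCompl (· ∈ U)).symm.trans (Equiv.sumComm _ _)
  have : toParametric U = ((renameEquiv K e).trans (sumAlgEquiv K _ _)).toAlgHom := by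
    ext i : 1
    by_cases hi : i ∈ U <;> simp [toParametric, e, hi]
  rw [this]
  exact AlgEquiv.bijective _

lemma toParametric_rename (g : MvPolynomial {i // i ∈ U} K) :
    toParametric U (rename Subtype.val g) = C g := by
  have : (toParametric U).comp (rename Subtype.val) =
      IsScalarTower.toAlgHom K (MvPolynomial {i // i ∈ U} K) _ := by
    ext i : 1
    simp [toParametric, algebraMap_eq]
  exact DFunLike.congr_fun this g

lemma comap_C_eq_bot_iff_independentFor
    {I : Ideal (MvPolynomial {i // i ∉ U} (MvPolynomial {i // i ∈ U} K))} :
    I.comap C = ⊥ ↔ IndependentFor U (I.comap (toParametric U)) := by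
  simp only [Submodule.eq_bot_iff, IndependentFor, Ideal.mem_comap, toParametric_rename]

lemma comap_C_idealHT_eq_bot_iff :
    (idealHT U H t).comap C = ⊥ ↔ IndependentFor U (H ⊔ Ideal.span (Set.range t)) := by
  rw [comap_C_eq_bot_iff_independentFor, idealHT,
    Ideal.comap_map_of_bijective _ (toParametric_bijective U)]

lemma idealHTz_eq_rabinowitschIdeal :
    idealHTz U H t = rabinowitschIdeal (H.map (toParametric U)) (toParametric U ∘ t) := by
  rw [idealHTz, Ideal.span_union, rabinowitschIdeal]
  congr 1
  exact (Ideal.map_map (toParametric U).toRingHom (rename Sum.inl).toRingHom).symm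

lemma comap_toParametric_comap_radical_idealHTz :
    ((idealHTz U H t).radical.comap (rename Sum.inl)).comap (toParametric U) =
      H.radical.colon (Set.range t) := by
  rw [idealHTz_eq_rabinowitschIdeal, comap_radical_rabinowitschIdeal, Set.range_comp]
  refine (comap_colon_image (toParametric U).toRingHom _ _).trans ?_
  rw [Ideal.comap_radical]
  congr 2
  exact Ideal.comap_map_of_bijective _ (toParametric_bijective U)

lemma comap_C_idealHTz_eq_bot_iff :
    (idealHTz U H t).comap C = ⊥ ↔ IndependentFor U (H.radical.colon (Set.range t)) := by
  rw [← comap_toParametric_comap_radical_idealHTz, ← comap_C_eq_bot_iff_independentFor,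
    ← comap_radical_eq_bot_iff]
  simp only [Submodule.eq_bot_iff, Ideal.mem_comap, rename_C]

lemma vanishesOn_iff_range_subset [IsAlgClosed K] (hP : P.IsPrime) :
    VanishesOn t P ↔ Set.range t ⊆ P := by
  conv_rhs => rw [← IsPrime.vanishingIdeal_zeroLocus (K := K) P]
  rw [Set.range_subset_iff]
  simp only [VanishesOn, SetLike.mem_coe, mem_vanishingIdeal_iff, aeval_eq_eval]
  exact ⟨fun h j a ha => h a ha j, fun h a ha j => h j a ha⟩

lemma IndependentFor.card_le_ringKrullDim (hP : P.IsPrime) (hU : IndependentFor U P) :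
    (U.card : WithBot ℕ∞) ≤ ringKrullDim (MvPolynomial (Fin n) K ⧸ P) := by
  let x : {i // i ∈ U} → MvPolynomial (Fin n) K ⧸ P := fun i => Ideal.Quotient.mk P (X i.1)
  have hx : aeval x = (Ideal.Quotient.mkₐ K P).comp (rename Subtype.val) := by
    ext i : 1
    simp [x]
  have hind : AlgebraicIndependent K x := algebraicIndependent_iff.mpr fun g hg =>
    hU g (Ideal.Quotient.eq_zero_iff_mem.mp ((DFunLike.congr_fun hx g).symm.trans hg))
  simpa using natCard_le_ringKrullDim_of_algebraicIndependent hind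

lemma mem_independentComponents_of_isPrime
    (hdim : ringKrullDim (MvPolynomial (Fin n) K ⧸ H) ≤ U.card)
    (hP : P.IsPrime) (hHP : H ≤ P) (hU : IndependentFor U P) : P ∈ independentComponents U H := by
  obtain ⟨P₀, hP₀, hle⟩ := Ideal.exists_minimalPrimes_le hHP
  rcases hle.eq_or_lt with rfl | hlt
  · exact ⟨hP₀, hU⟩
  have := hP₀.1.1
  have hcard : ((U.card + 1 : ℕ) : WithBot ℕ∞) ≤ U.card := calc
    ((U.card + 1 : ℕ) : WithBot ℕ∞) ≤ ringKrullDim (MvPolynomial (Fin n) K ⧸ P) + 1 := by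
        push_cast
        exact add_le_add_left (hU.card_le_ringKrullDim hP) 1
    _ ≤ ringKrullDim (MvPolynomial (Fin n) K ⧸ P₀) := ringKrullDim_quotient_add_one_le_of_lt hlt
    _ ≤ ringKrullDim (MvPolynomial (Fin n) K ⧸ H) :=
        ringKrullDim_le_of_surjective _ (Ideal.Quotient.factor_surjective hP₀.1.2)
    _ ≤ U.card := hdim
  exact absurd (Nat.cast_le.mp hcard) U.card.lt_irrefl

lemma independentFor_sup_span_iff [IsAlgClosed K]
    (hdim : ringKrullDim (MvPolynomial (Fin n) K ⧸ H) ≤ U.card) :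
    IndependentFor U (H ⊔ Ideal.span (Set.range t)) ↔
      ∃ P ∈ independentComponents U H, VanishesOn t P := by
  constructor
  · intro h
    obtain ⟨P, hP, hU⟩ := h.exists_minimalPrimes
    have hle := hP.1.2
    rw [sup_le_iff, Ideal.span_le] at hle
    exact ⟨P, mem_independentComponents_of_isPrime hdim hP.1.1 hle.1 hU,
      (vanishesOn_iff_range_subset hP.1.1).mpr hle.2⟩
  · rintro ⟨P, ⟨hP, hU⟩, ht⟩
    exact hU.mono
      (sup_le hP.1.2 (Ideal.span_le.mpr ((vanishesOn_iff_range_subset hP.1.1).mp ht)))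

lemma independentFor_radical_colon_iff [IsAlgClosed K] :
    IndependentFor U (H.radical.colon (Set.range t)) ↔
      ∃ Q ∈ independentComponents U H, ¬ VanishesOn t Q := by
  constructor
  · intro h
    obtain ⟨P, hP, hU⟩ := h.exists_minimalPrimes
    have := hP.1.1
    obtain ⟨Q, hQ, hQP, ht⟩ := exists_minimalPrimes_le_of_radical_colon_le hP.1.2
    exact ⟨Q, ⟨hQ, hU.mono hQP⟩, mt (vanishesOn_iff_range_subset hQ.1.1).mp ht⟩
  · rintro ⟨Q, ⟨hQ, hU⟩, ht⟩
    have := hQ.1.1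
    exact hU.mono
      (radical_colon_le_of_isPrime hQ.1.2 (mt (vanishesOn_iff_range_subset hQ.1.1).mpr ht))

end Elimination

end ParamGB

theorem corollary10_general {K : Type*} [Field K] [IsAlgClosed K] {n r : ℕ}
    (H : Ideal (MvPolynomial (Fin n) K)) (t : Fin r → MvPolynomial (Fin n) K)
    (U : Finset (Fin n)) (hdim : ringKrullDim (MvPolynomial (Fin n) K ⧸ H) ≤ U.card)
    (m₁ : MonomialOrder ({i // i ∉ U} ⊕ Fin r)) (m₂ : MonomialOrder {i // i ∉ U})
    (𝒢₁ : ParamGB.System ({i // i ∉ U} ⊕ Fin r) {i // i ∈ U} K) (hpart₁ : 𝒢₁.IsPartition)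
    (hspec₁ : 𝒢₁.SpecializesToReduced m₁ (ParamGB.idealHTz U H t))
    (𝒢₂ : ParamGB.System {i // i ∉ U} {i // i ∈ U} K) (hpart₂ : 𝒢₂.IsPartition)
    (hspec₂ : 𝒢₂.SpecializesToReduced m₂ (ParamGB.idealHT U H t)) :
    ((∃ P ∈ ParamGB.independentComponents U H, ParamGB.VanishesOn t P) ∧
      (∃ Q ∈ ParamGB.independentComponents U H, ¬ ParamGB.VanishesOn t Q)) ↔
    (𝒢₁.GenericBasisNeOne ∧ 𝒢₂.GenericBasisNeOne) := by
  rw [ParamGB.System.genericBasisNeOne_iff hpart₁ hspec₁,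
    ParamGB.System.genericBasisNeOne_iff hpart₂ hspec₂, ParamGB.comap_C_idealHTz_eq_bot_iff,
    ParamGB.comap_C_idealHT_eq_bot_iff, ParamGB.independentFor_radical_colon_iff,
    ParamGB.independentFor_sup_span_iff hdim, and_comm]

theorem corollary10 {K : Type*} [Field K] [IsAlgClosed K] {n r : ℕ}
    (H : Ideal (MvPolynomial (Fin n) K)) (t : Fin r → MvPolynomial (Fin n) K)
    (U : Finset (Fin n)) (hU : ParamGB.IndependentFor U H)
    (hdim : ringKrullDim (MvPolynomial (Fin n) K ⧸ H) = (U.card : WithBot ℕ∞))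
    (m₁ : MonomialOrder ({i // i ∉ U} ⊕ Fin r)) (m₂ : MonomialOrder {i // i ∉ U})
    (𝒢₁ : ParamGB.System ({i // i ∉ U} ⊕ Fin r) {i // i ∈ U} K)
    (h𝒢₁ : 𝒢₁.IsMCCGS m₁ (ParamGB.idealHTz U H t))
    (𝒢₂ : ParamGB.System {i // i ∉ U} {i // i ∈ U} K)
    (h𝒢₂ : 𝒢₂.IsMCCGS m₂ (ParamGB.idealHT U H t)) :
    ((∃ P ∈ ParamGB.independentComponents U H, ParamGB.VanishesOn t P) ∧
      (∃ Q ∈ ParamGB.independentComponents U H, ¬ ParamGB.VanishesOn t Q)) ↔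
    (𝒢₁.GenericBasisNeOne ∧ 𝒢₂.GenericBasisNeOne) := by
  exact corollary10_general H t U hdim.le m₁ m₂ 𝒢₁ h𝒢₁.partition h𝒢₁.specializes 𝒢₂
    h𝒢₂.partition h𝒢₂.specializes
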